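/- **Adinkras.** An Adinkra with $N$ ordered edge colours is a connected simple bipartite graph whose edges are partitioned into $N$ colour classes such that every vertex meets exactly one edge of each colour, together with: a labelling of the two sides of the bipartition as bosons and fermions; a height function $V\to\mathbb Z$ that changes by exactly $1$ along each edge; and an edge parity $\pi:E\to\mathbb Z_2$ (solid/dashed). It is required that every path of length two with distinct colours $(i,j)$ closes up to a 4-cycle with colours $(i,j,i,j)$, and that each such 4-cycle has an odd number of dashed edges. It is an $(N,k)$ Adinkra if $k \le N$ and $|V|=2^{N-k}$. Two Adinkras are equivalent if one is obtained from the other by relabelling vertices (preserving edge colours, bosons and fermions), switching vertices (reversing the parity of all edges at a vertex) and changing the heights. The code of an Adinkra is the set of $c\in\mathbb Z_2^N$ such that traversing, from any vertex, one edge of each colour $i$ with $c_i=1$ returns to that vertex. A code is doubly even if all its words have weight divisible by $4$. A standard form for a code $C\subseteq \mathbb Z_2^N$ of dimension $k$ consists of an enumeration of the $N$ coordinates as $n=N-k$ "cube" coordinates and $k$ "extra" coordinates and a $k\times n$ matrix $A$ over $\mathbb Z_2$ such that the rows of $(I\mid A)$ ($I$ on the extra, $A$ on the cube coordinates) generate $C$.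 **Landweber's construction.** Let $v\in\mathbb Z_2^n$ stand for the product $\gamma^v$ of the Clifford generators $\gamma_j$ with $v_j=1$, in increasing order, where $\gamma_j^2=1$ and $\gamma_i\gamma_j=-\gamma_j\gamma_i$ for $i \neq j$. Given a standard form with matrix $A$ with rows $A_1,\dots,A_k$, a global sign $(-1)^{\varepsilon}$, and a choice $b$ of whether the even-weight or the odd-weight vertices are the bosons, let $L(A,\varepsilon,b)$ have vertex set $\mathbb Z_2^n$ and the following edges. The edge of the $j$-th cube colour at $v$ leads to $v+e_j$, with parity given by left Clifford multiplication, $\pi(v)=v_1+\dots+v_{j-1}$ (the standard form $n$-cube Adinkra). The edge of the $i$-th extra colour at $v$ leads to $v+A_i$, with parity given by right Clifford multiplication of $v$ by $A_i$, times $(-1)^F$ (with $F=|v|$), times the global sign: $$\pi(v)=\sum_{q<p} v_p\,(A_i)_q+\sum_j v_j+\varepsilon \pmod 2 .$$ (Heights: bosons at $0$, fermions at $1$.) **Theorem.** 1. If $C$ is a doubly even code with a standard form $A$, having $k$ rows, then each $L(A,\varepsilon,b)$ is an $(N,k)$ Adinkra with code $C$. 2. Conversely, let $G$ be an $(N,k)$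 Adinkra. Its code $C$ is a doubly even linear code of dimension $k$ and has a standard form. For every standard form of $C$, with matrix $A$, the Adinkra $G$ is equivalent to one given by the construction; more precisely, for each sign $\varepsilon$ there is a choice $b$ of the bosons such that $G$ is equivalent to $L(A,\varepsilon,b)$. If $k$ is odd, or if the word $(1,1,\dots,1)$ is not in $C$, then also for each choice $b$ there is a global sign $\varepsilon$ on the extra edges such that $G$ is equivalent to $L(A,\varepsilon,b)$. 3. For each code there are at most two equivalence classes of Adinkras with that code: among any three Adinkras with the same code, two are equivalent. -/

import Mathlib

/-- Raw data of an edge-coloured graph with `N` ordered edge colours on the vertex set `V`,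
together with the two vertex colourings and the edge parity of an Adinkra.
`nbr i v` is the other end of the `i`-th edge at `v`, and `parity i v` is the parity of that edge
(`0` and `1` for the two edge types, solid and dashed). `fermion v` is `0` if `v` is a boson and
`1` if `v` is a fermion. -/
structure AdinkraData (N : ℕ) (V : Type*) where
  nbr : Fin N → V → V
  parity : Fin N → V → ZMod 2
  fermion : V → ZMod 2
  hgt : V → ℤ

namespace AdinkraData

variable {N : ℕ} {V : Type*} {W : Type*}

/-- The underlying uncoloured graph (the topology). -/
def graph (G : AdinkraData N V) : SimpleGraph V :=
  SimpleGraph.fromRel fun u v => ∃ i, G.nbr i u = v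

/-- `G` is a (connected) Adinkra: a connected simple bipartite graph whose edges are partitioned
into `N` perfect matchings, such that every two-coloured path of colours `i, j` closes up to a
4-cycle of colours `i, j, i, j`, all these 4-cycles having an odd number of dashed edges. -/
structure IsAdinkra (G : AdinkraData N V) : Prop where
  connected : G.graph.Connected
  /-- each colour class is a perfect matching -/
  nbr_nbr : ∀ i v, G.nbr i (G.nbr i v) = v
  nbr_ne : ∀ i v, G.nbr i v ≠ v
  /-- there are no multiple edges -/
  simple : ∀ i j v, i ≠ j → G.nbr i v ≠ G.nbr j v
  /-- bosons are adjacent only to fermions, and conversely -/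
  bipartite : ∀ i v, G.fermion (G.nbr i v) = G.fermion v + 1
  /-- adjacent vertices are at adjacent heights -/
  adjacent_hgt : ∀ i v, |G.hgt (G.nbr i v) - G.hgt v| = 1
  /-- the parity belongs to the edge, not to an end of it -/
  parity_nbr : ∀ i v, G.parity i (G.nbr i v) = G.parity i v
  /-- two-coloured paths of length two close up to 4-cycles -/
  four_cycle : ∀ i j v, i ≠ j → G.nbr j (G.nbr i (G.nbr j (G.nbr i v))) = v
  /-- two-coloured 4-cycles have an odd number of dashed edges -/
  odd_dashing : ∀ i j v, i ≠ j →
    G.parity i v + G.parity j (G.nbr i v) + G.parity i (G.nbr j (G.nbr i v))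
      + G.parity j (G.nbr i (G.nbr j (G.nbr i v))) = 1

/-- An Adinkra with `N` edge colours is an `(N, k)` Adinkra if it has `2 ^ (N - k)` vertices. -/
def IsNK (G : AdinkraData N V) (k : ℕ) : Prop :=
  G.IsAdinkra ∧ k ≤ N ∧ Nat.card V = 2 ^ (N - k)

/-- Starting at `v`, traverse one edge of each of the colours `i` with `c i = 1`
(in an Adinkra the order does not matter). -/
def move (G : AdinkraData N V) (c : Fin N → ZMod 2) (v : V) : V :=
  (List.finRange N).foldr (fun i u => if c i = 1 then G.nbr i u else u) v

/-- `C` is the code associated with `G`: its words are the sets of edge colours whose traversal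
closes up. Equivalently, vertices of the `N`-cube are identified in `G` exactly if they differ by
an element of `C`. -/
def HasCode (G : AdinkraData N V) (C : Submodule (ZMod 2) (Fin N → ZMod 2)) : Prop :=
  ∀ c, c ∈ C ↔ ∀ v, G.move c v = v

/-- Equivalence of Adinkras: `H` arises from `G` by relabelling the vertices along `e`
(respecting edge colours, bosons and fermions), switching the vertices `v` with `s v = 1`, and
raising or lowering vertices, that is, changing the height function arbitrarily. Any sequence of
such operations can be composed into one of this form. -/
def Equivalent (G : AdinkraData N V) (H : AdinkraData N W) : Prop :=
  ∃ (e : V ≃ W) (s : V → ZMod 2),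
    (∀ i v, e (G.nbr i v) = H.nbr i (e v)) ∧
    (∀ v, H.fermion (e v) = G.fermion v) ∧
    (∀ i v, H.parity i (e v) = G.parity i v + s v + s (G.nbr i v))

end AdinkraData

/-- A code is doubly even if all its words have weight divisible by four. -/
def DoublyEven {N : ℕ} (C : Submodule (ZMod 2) (Fin N → ZMod 2)) : Prop :=
  ∀ c ∈ C, 4 ∣ hammingNorm c

/-- The `i`-th row of the generator matrix `(I | A)`, where the columns of `I` are placed at the
coordinates `σ (inr i)`, and those of `A` at the coordinates `σ (inl j)`. -/
def standardRow {N n k : ℕ} (σ : Fin n ⊕ Fin k ≃ Fin N) (A : Matrix (Fin k) (Fin n) (ZMod 2))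
    (i : Fin k) : Fin N → ZMod 2 :=
  fun c => Sum.elim (A i) ((1 : Matrix (Fin k) (Fin k) (ZMod 2)) i) (σ.symm c)

/-- `(I | A)` is a standard form generator matrix of `C` with respect to the ordering `σ` of the
coordinates. -/
def IsStandardForm {N n k : ℕ} (C : Submodule (ZMod 2) (Fin N → ZMod 2))
    (σ : Fin n ⊕ Fin k ≃ Fin N) (A : Matrix (Fin k) (Fin n) (ZMod 2)) : Prop :=
  C = Submodule.span (ZMod 2) (Set.range (standardRow σ A))

/-- The exponent of the sign in the Clifford multiplication of bit-strings
`γ^v * γ^w = (-1) ^ cliffordSign v w * γ^(v + w)`; see `cliffordMonomial_mul`. -/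
def cliffordSign {n : ℕ} (v w : Fin n → ZMod 2) : ZMod 2 :=
  ∑ p, v p * ∑ q with q < p, w q

/-- The ordered product `γ^v` of the generators `γ i` with `v i = 1`. -/
def cliffordMonomial {R : Type*} [Ring R] {n : ℕ} (γ : Fin n → R) (v : Fin n → ZMod 2) : R :=
  (List.ofFn fun i => γ i ^ (v i).val).prod

theorem cliffordSign_succ {n : ℕ} (v w : Fin (n + 1) → ZMod 2) :
    cliffordSign v w =
      w 0 * ∑ p : Fin n, v p.succ + cliffordSign (fun i => v i.succ) (fun i => w i.succ) := by
  have key : ∀ p : Fin n, (∑ q with q < p.succ, w q) = w 0 + ∑ q with q < p, w q.succ := by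
    intro p
    simp [Finset.sum_filter, Fin.sum_univ_succ]
  have key0 : (∑ q : Fin (n + 1) with q < 0, w q) = 0 := by simp
  unfold cliffordSign
  rw [Fin.sum_univ_succ, key0, mul_zero, zero_add, Finset.mul_sum, ← Finset.sum_add_distrib]
  refine Finset.sum_congr rfl fun p _ => ?_
  rw [key]
  ring

theorem pow_val_add_of_mul_self {R : Type*} [Ring R] {g : R} (hg : g * g = 1) (a b : ZMod 2) :
    g ^ (a + b).val = g ^ a.val * g ^ b.val := by
  rw [ZMod.val_add, ← pow_eq_pow_mod _ (by rw [pow_two, hg]), pow_add]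

theorem neg_one_pow_val_add {R : Type*} [Ring R] (a b : ZMod 2) :
    (-1 : R) ^ (a + b).val = (-1) ^ a.val * (-1) ^ b.val :=
  pow_val_add_of_mul_self (by simp) a b

theorem bit_eq_zero_or_one (z : ZMod 2) : z = 0 ∨ z = 1 := by
  revert z; decide

theorem cliffordMonomial_succ {R : Type*} [Ring R] {n : ℕ} (γ : Fin (n + 1) → R)
    (v : Fin (n + 1) → ZMod 2) :
    cliffordMonomial γ v =
      γ 0 ^ (v 0).val * cliffordMonomial (fun i => γ i.succ) (fun i => v i.succ) := by
  simp [cliffordMonomial, List.ofFn_succ]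

theorem cliffordMonomial_mul_pow {R : Type*} [Ring R] {n : ℕ} (γ : Fin n → R) (g : R)
    (h : ∀ i, γ i * g = -(g * γ i)) (v : Fin n → ZMod 2) (z : ZMod 2) :
    cliffordMonomial γ v * g ^ z.val =
      (-1) ^ (z * ∑ i, v i).val * (g ^ z.val * cliffordMonomial γ v) := by
  obtain rfl | rfl := bit_eq_zero_or_one z
  · simp
  induction n with
  | zero => simp [cliffordMonomial]
  | succ n ih =>
    have ih' := ih (fun i => γ i.succ) (fun i => h i.succ) (fun i => v i.succ)
    have h0 : ∀ x : ZMod 2, γ 0 ^ x.val * g = (-1) ^ x.val * (g * γ 0 ^ x.val) := by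
      intro x
      obtain rfl | rfl := bit_eq_zero_or_one x <;> simp [ZMod.val_one, h 0]
    simp only [one_mul, ZMod.val_one, pow_one] at ih' ⊢
    rw [cliffordMonomial_succ, Fin.sum_univ_succ, neg_one_pow_val_add, mul_assoc, ih',
      ← mul_assoc (γ 0 ^ _), ((Commute.neg_one_right (γ 0 ^ (v 0).val)).pow_right _).eq,
      mul_assoc, ← mul_assoc (γ 0 ^ _), h0]
    have hc := ((Commute.neg_one_left ((-1 : R) ^ (v 0).val)).pow_left
      (∑ i : Fin n, v i.succ).val).eq
    simp only [← mul_assoc]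
    rw [hc]

/-- `cliffordSign` is the sign of multiplication in the Clifford algebra, where the generators
satisfy `γ i * γ i = 1` and `γ i * γ j = - γ j * γ i`. -/
theorem cliffordMonomial_mul {R : Type*} [Ring R] {n : ℕ} (γ : Fin n → R)
    (hsq : ∀ i, γ i * γ i = 1) (hanti : ∀ i j, i ≠ j → γ i * γ j = -(γ j * γ i))
    (v w : Fin n → ZMod 2) :
    cliffordMonomial γ v * cliffordMonomial γ w =
      (-1) ^ (cliffordSign v w).val * cliffordMonomial γ (v + w) := by
  induction n with
  | zero => simp [cliffordMonomial, cliffordSign]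
  | succ n ih =>
    have ih' := ih (fun i => γ i.succ) (fun i => hsq i.succ)
      (fun i j hij => hanti _ _ fun h => hij (Fin.succ_injective _ h))
      (fun i => v i.succ) (fun i => w i.succ)
    have hm := cliffordMonomial_mul_pow (fun i => γ i.succ) (γ 0)
      (fun i => hanti _ _ (Fin.succ_ne_zero i)) (fun i => v i.succ) (w 0)
    have hp : ∀ a b : ZMod 2, γ 0 ^ a.val * γ 0 ^ b.val = γ 0 ^ (a + b).val :=
      fun a b => (pow_val_add_of_mul_self (hsq 0) a b).symm
    have hc : ∀ (x : R) (m : ℕ), x * (-1) ^ m = (-1) ^ m * x := fun x m =>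
      ((Commute.neg_one_right x).pow_right m).eq
    rw [cliffordMonomial_succ γ v, cliffordMonomial_succ γ w, cliffordMonomial_succ γ (v + w),
      cliffordSign_succ, neg_one_pow_val_add]
    set X := cliffordMonomial (fun i => γ i.succ) (fun i => v i.succ)
    set Y := cliffordMonomial (fun i => γ i.succ) (fun i => w i.succ)
    calc γ 0 ^ (v 0).val * X * (γ 0 ^ (w 0).val * Y)
        = γ 0 ^ (v 0).val * (X * γ 0 ^ (w 0).val) * Y := by simp only [mul_assoc]
      _ = (-1) ^ (w 0 * ∑ i : Fin n, v i.succ).val *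
            (γ 0 ^ (v 0).val * γ 0 ^ (w 0).val) * (X * Y) := by
          rw [hm, ← mul_assoc (γ 0 ^ _), hc]; simp only [mul_assoc]
      _ = _ := by
          rw [ih', hp, mul_assoc, ← mul_assoc (γ 0 ^ _), hc]
          simp only [mul_assoc]
          rfl

/-- Landweber's construction. The vertices are the bit-strings of length `n`, and the colour
`σ (inl j)` is the `j`-th colour of the standard form `n`-cube Adinkra: its edge at `v` leads to
`v + e_j`, with parity given by left Clifford multiplication of `v` by `γ_j`. The colour
`σ (inr i)` is the `i`-th extra colour: its edge at `v` leads to `v + A_i`, with parity given by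
right Clifford multiplication of `v` by `A_i`, times `(-1) ^ F`, times the global sign
`(-1) ^ ε`; here odd-weight vertices are the fermions for the purposes of `(-1) ^ F`.
The bosons are the vertices of even weight if `b = 0` and those of odd weight if `b = 1`. Heights,
which do not matter for equivalence, are put on two levels. -/
def landweber {N n k : ℕ} (σ : Fin n ⊕ Fin k ≃ Fin N) (A : Matrix (Fin k) (Fin n) (ZMod 2))
    (ε b : ZMod 2) : AdinkraData N (Fin n → ZMod 2) where
  nbr c v := v + Sum.elim (fun j => Pi.single j 1) A (σ.symm c)
  parity c v := Sum.elim (fun j => cliffordSign (Pi.single j 1) v)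
    (fun i => cliffordSign v (A i) + ∑ j, v j + ε) (σ.symm c)
  fermion v := b + ∑ j, v j
  hgt v := ((b + ∑ j, v j).val : ℤ)

/-!
Everything is read off from signed permutations. In an Adinkra `G`, each colour `i` acts on the
free abelian group on the vertices by `v ↦ (-1) ^ (parity of the edge) • (neighbour of v)`; the
four-cycle axioms say that these operators `AdinkraData.gamma` are Clifford generators. Hence the
multiplication law `cliffordMonomial_mul` shows at once that traversing sets of colours is an
action of `(ZMod 2) ^ N` on the vertices, and that the parity `moveParity c v` of the walk along
the word `c` from `v` satisfies a cocycle identity with the Clifford sign `cliffordSign`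
(`IsAdinkra.move_move`, `IsAdinkra.moveParity_move`). As the graph is connected, the vertices are
a torsor under `(ZMod 2) ^ N` modulo the code `C`. For `c ∈ C`, the monomial of `c` maps each
vertex to itself up to sign, so that it squares to `1`; as `c` has even weight by bipartiteness,
its weight is divisible by four.

The cocycle identity also shows that an Adinkra is determined up to equivalence by its code, the
parities of the closed walks `c ∈ C` at one base vertex and whether this vertex is a boson
(`IsAdinkra.equivalent_of_moveParity_eq`): the switching function at the end of a walk is the
difference of the parities of the walk in the two Adinkras. For two Adinkras with the same code,
the parities of closed walks differ by a linear functional on `C`, that is, by `c ↦ x ⬝ c` for some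
word `x`, and moving the base vertex along `x` changes the parities by just this functional, since
`x ⬝ c` is the commutation sign of the two monomials (`IsAdinkra.exists_moveParity_move_eq`). So
only the statistics of the base vertex remain, which gives the choice `b` for each sign and the
bound by two classes. If `b` is prescribed, the base vertex may have to be moved by a further word
of odd weight: one orthogonal to `C`, which exists if the all-ones word is not in `C`, or, if `k`
is odd, the word of all extra colours, which amounts to flipping the global sign.

That Landweber's construction is an Adinkra is a computation with the bilinear form `cliffordSign`.
For a doubly even code, each row of `A` has weight `3` modulo four and the sum of two rows has
weight `2` modulo four, and the square of a Clifford monomial of degree `m` has the sign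
`(-1) ^ (m.choose 2)`; this gives the signs needed for `landweber_odd_dashing`. The other part is
that each code has a standard form (`exists_isStandardForm`).
-/

theorem bits_add_self {ι : Type*} (c : ι → ZMod 2) : c + c = 0 :=
  funext fun i => CharTwo.add_self_eq_zero (c i)

/-! ### The Clifford sign as a bilinear form -/

theorem cliffordSign_add_left {n : ℕ} (u v w : Fin n → ZMod 2) :
    cliffordSign (u + v) w = cliffordSign u w + cliffordSign v w := by
  simp [cliffordSign, add_mul, Finset.sum_add_distrib]

theorem cliffordSign_add_right {n : ℕ} (u v w : Fin n → ZMod 2) :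
    cliffordSign u (v + w) = cliffordSign u v + cliffordSign u w := by
  simp [cliffordSign, mul_add, Finset.sum_add_distrib]

/-- The commutation sign of two Clifford monomials. -/
theorem cliffordSign_add_swap {n : ℕ} (v w : Fin n → ZMod 2) :
    cliffordSign v w + cliffordSign w v = (∑ i, v i) * (∑ i, w i) + ∑ i, v i * w i := by
  induction n with
  | zero => simp [cliffordSign]
  | succ n ih =>
    have h := ih (fun i => v i.succ) (fun i => w i.succ)
    have h2 : (2 : ZMod 2) = 0 := rfl
    simp only [cliffordSign_succ, Fin.sum_univ_succ]
    linear_combination h - (v 0 * w 0) * h2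

theorem natCast_hammingNorm {ι : Type*} [Fintype ι] (v : ι → ZMod 2) :
    (hammingNorm v : ZMod 2) = ∑ i, v i := by
  rw [hammingNorm, Finset.card_filter, Nat.cast_sum]
  refine Finset.sum_congr rfl fun i _ => ?_
  obtain h | h := bit_eq_zero_or_one (v i) <;> simp [h]

theorem hammingNorm_eq_sum {ι : Type*} [Fintype ι] (v : ι → ZMod 2) :
    hammingNorm v = ∑ i, (v i).val := by
  rw [hammingNorm, Finset.card_filter]
  refine Finset.sum_congr rfl fun i _ => ?_
  obtain h | h := bit_eq_zero_or_one (v i) <;> simp [h, ZMod.val_one]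

/-- The square of a Clifford monomial of degree `m` is `(-1) ^ (m.choose 2)`. -/
theorem cliffordSign_self {n : ℕ} (v : Fin n → ZMod 2) :
    cliffordSign v v = ((hammingNorm v).choose 2 : ℕ) := by
  induction n with
  | zero => simp [cliffordSign, hammingNorm_eq_sum]
  | succ n ih =>
    have h := ih (fun i => v i.succ)
    have hs : hammingNorm v = (v 0).val + hammingNorm (fun i : Fin n => v i.succ) := by
      simp [hammingNorm_eq_sum, Fin.sum_univ_succ]
    rw [cliffordSign_succ, h, hs, ← natCast_hammingNorm]
    obtain h0 | h0 := bit_eq_zero_or_one (v 0)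
    · simp [h0]
    · rw [h0, ZMod.val_one, add_comm 1, Nat.choose_succ_succ' _ 1]
      simp

theorem natCast_choose_two_add_four_mul (r q : ℕ) :
    (((r + 4 * q).choose 2 : ℕ) : ZMod 2) = (r.choose 2 : ℕ) := by
  induction q with
  | zero => simp
  | succ q ih =>
    rw [← ih, show r + 4 * (q + 1) = r + 4 * q + 1 + 1 + 1 + 1 by ring]
    simp only [Nat.choose_succ_succ' _ 1, Nat.choose_one_right]
    push_cast
    ring_nf
    reduce_mod_char

theorem natCast_choose_two_mod_four (m : ℕ) :
    ((m.choose 2 : ℕ) : ZMod 2) = ((m % 4).choose 2 : ℕ) := by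
  conv_lhs => rw [← Nat.mod_add_div m 4]
  exact natCast_choose_two_add_four_mul _ _

/-- A word has weight divisible by four exactly if its Clifford monomial is even
and squares to `1`. -/
theorem four_dvd_hammingNorm_of {n : ℕ} {v : Fin n → ZMod 2} (h₁ : ∑ i, v i = 0)
    (h₂ : cliffordSign v v = 0) : 4 ∣ hammingNorm v := by
  rw [← natCast_hammingNorm, ZMod.natCast_eq_zero_iff] at h₁
  rw [cliffordSign_self, natCast_choose_two_mod_four] at h₂
  have h : hammingNorm v % 4 < 4 := Nat.mod_lt _ (by norm_num)
  have h' : hammingNorm v % 4 ≠ 2 := by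
    intro h3
    rw [h3] at h₂
    exact absurd h₂ (by decide)
  omega

theorem hammingNorm_single {ι : Type*} [Fintype ι] [DecidableEq ι] (i : ι) :
    hammingNorm (Pi.single i 1 : ι → ZMod 2) = 1 := by
  rw [hammingNorm_eq_sum, Finset.sum_eq_single i] <;> simp +contextual [ZMod.val_one]

theorem cliffordSign_single_self {n : ℕ} (j : Fin n) :
    cliffordSign (Pi.single j 1) (Pi.single j 1) = 0 := by
  rw [cliffordSign_self, hammingNorm_single]
  simp

theorem cliffordSign_single_add_swap {n : ℕ} {i j : Fin n} (h : i ≠ j) :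
    cliffordSign (Pi.single i 1) (Pi.single j 1) +
      cliffordSign (Pi.single j 1) (Pi.single i 1) = 1 := by
  simp [cliffordSign_add_swap, Pi.single_apply, h.symm]

/-! ### Walks in an Adinkra and their parity -/

namespace AdinkraData

universe u v

variable {N : ℕ} {V : Type u} {W : Type v}

/-- The walk from `v` along one edge of each of the colours `i` in `l` with `c i = 1`, the last
colour of the list first. -/
def walkEnd (G : AdinkraData N V) (c : Fin N → ZMod 2) (l : List (Fin N)) (v : V) : V :=
  l.foldr (fun i u => if c i = 1 then G.nbr i u else u) v

/-- The number of dashed edges, modulo two, along the walk of `walkEnd`. -/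
def walkParity (G : AdinkraData N V) (c : Fin N → ZMod 2) : List (Fin N) → V → ZMod 2
  | [], _ => 0
  | i :: l, v => c i * G.parity i (G.walkEnd c l v) + walkParity G c l v

/-- The parity of the walk from `v` to `G.move c v`. -/
def moveParity (G : AdinkraData N V) (c : Fin N → ZMod 2) (v : V) : ZMod 2 :=
  G.walkParity c (List.finRange N) v

theorem walkEnd_cons (G : AdinkraData N V) (c : Fin N → ZMod 2) (i : Fin N) (l : List (Fin N))
    (v : V) : G.walkEnd c (i :: l) v =
      if c i = 1 then G.nbr i (G.walkEnd c l v) else G.walkEnd c l v := rfl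

theorem move_eq_walkEnd (G : AdinkraData N V) (c : Fin N → ZMod 2) (v : V) :
    G.move c v = G.walkEnd c (List.finRange N) v := rfl

/-- The signed permutation operator of the colour `i` on the free abelian group on the vertices.
In an Adinkra, these operators are Clifford generators. -/
noncomputable def gamma (G : AdinkraData N V) (i : Fin N) : Module.End ℤ (V →₀ ℤ) :=
  Finsupp.linearCombination ℤ fun v => Finsupp.single (G.nbr i v) ((-1) ^ (G.parity i v).val)

theorem gamma_single (G : AdinkraData N V) (i : Fin N) (v : V) (a : ℤ) :
    G.gamma i (Finsupp.single v a) =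
      Finsupp.single (G.nbr i v) (a * (-1) ^ (G.parity i v).val) := by
  simp [gamma, Finsupp.linearCombination_single]

theorem cliffordMonomial_gamma_single (G : AdinkraData N V) (c : Fin N → ZMod 2) (v : V) :
    cliffordMonomial G.gamma c (Finsupp.single v 1) =
      Finsupp.single (G.move c v) ((-1) ^ (G.moveParity c v).val) := by
  have key : ∀ l : List (Fin N),
      (l.map fun i => G.gamma i ^ (c i).val).prod (Finsupp.single v 1) =
        Finsupp.single (G.walkEnd c l v) ((-1) ^ (G.walkParity c l v).val) := by
    intro l
    induction l with
    | nil => simp [walkEnd, walkParity]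
    | cons i l ih =>
      rw [List.map_cons, List.prod_cons, Module.End.mul_apply, ih, walkEnd_cons, walkParity]
      obtain h | h := bit_eq_zero_or_one (c i)
      · simp [h]
      · simp only [h, ZMod.val_one, pow_one, gamma_single, if_true, one_mul, neg_one_pow_val_add]
        rw [mul_comm]
  rw [cliffordMonomial, List.ofFn_eq_map]
  exact key _

namespace IsAdinkra

variable {G : AdinkraData N V} {H : AdinkraData N W}

theorem nbr_comm (hG : G.IsAdinkra) {i j : Fin N} (h : i ≠ j) (v : V) :
    G.nbr i (G.nbr j (G.nbr i v)) = G.nbr j v := by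
  rw [← hG.nbr_nbr j (G.nbr i (G.nbr j (G.nbr i v))), hG.four_cycle i j v h]

theorem gamma_mul_self (hG : G.IsAdinkra) (i : Fin N) : G.gamma i * G.gamma i = 1 := by
  refine Finsupp.lhom_ext fun v a => ?_
  rw [Module.End.mul_apply, gamma_single, gamma_single, hG.nbr_nbr, hG.parity_nbr, mul_assoc,
    ← neg_one_pow_val_add, CharTwo.add_self_eq_zero]
  simp

theorem gamma_anticomm (hG : G.IsAdinkra) (i j : Fin N) (h : i ≠ j) :
    G.gamma i * G.gamma j = -(G.gamma j * G.gamma i) := by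
  refine Finsupp.lhom_ext fun v a => ?_
  have h1 := hG.nbr_comm h v
  have h2 : G.nbr i (G.nbr j v) = G.nbr j (G.nbr i v) := by rw [← h1, hG.nbr_nbr]
  have h3 := hG.odd_dashing i j v h
  rw [h1, hG.parity_nbr, ← h2, hG.parity_nbr] at h3
  have h4 : G.parity j v + G.parity i (G.nbr j v) =
      1 + (G.parity i v + G.parity j (G.nbr i v)) := by
    have h5 : (2 : ZMod 2) = 0 := rfl
    linear_combination h3 - (G.parity i v + G.parity j (G.nbr i v)) * h5
  rw [LinearMap.neg_apply, Module.End.mul_apply, Module.End.mul_apply, gamma_single, gamma_single,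
    gamma_single, gamma_single, mul_assoc, mul_assoc, ← neg_one_pow_val_add,
    ← neg_one_pow_val_add, h2, h4, neg_one_pow_val_add, ZMod.val_one, ← Finsupp.single_neg]
  simp

theorem move_move_and_moveParity (hG : G.IsAdinkra) (c d : Fin N → ZMod 2) (v : V) :
    G.move c (G.move d v) = G.move (c + d) v ∧
      G.moveParity d v + G.moveParity c (G.move d v) =
        cliffordSign c d + G.moveParity (c + d) v := by
  have h := congrArg (fun f => f (Finsupp.single v (1 : ℤ)))
    (cliffordMonomial_mul G.gamma hG.gamma_mul_self hG.gamma_anticomm c d)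
  have hs : ∀ (z : ZMod 2) (f : Module.End ℤ (V →₀ ℤ)) (x : V →₀ ℤ),
      ((-1) ^ z.val * f) x = ((-1 : ℤ) ^ z.val) • f x := by
    intro z f x
    obtain rfl | rfl := bit_eq_zero_or_one z <;> simp [ZMod.val_one]
  have hl : ∀ (f : Module.End ℤ (V →₀ ℤ)) (w : V) (a : ℤ),
      f (Finsupp.single w a) = a • f (Finsupp.single w 1) := by
    intro f w a
    rw [← map_smul]
    simp
  simp only [Module.End.mul_apply, hs, cliffordMonomial_gamma_single] at h
  rw [hl, cliffordMonomial_gamma_single, Finsupp.smul_single, Finsupp.smul_single, smul_eq_mul,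
    smul_eq_mul, ← neg_one_pow_val_add, ← neg_one_pow_val_add, Finsupp.single_eq_single_iff] at h
  have hinj : ∀ a b : ZMod 2, ((-1 : ℤ) ^ a.val = (-1) ^ b.val) → a = b := by decide
  rcases h with ⟨h1, h2⟩ | ⟨h1, -⟩
  · exact ⟨h1, hinj _ _ h2⟩
  · exact absurd h1 (pow_ne_zero _ (by norm_num))

/-- Traversing sets of colours is an action of the group of bit-strings on the vertices. -/
theorem move_move (hG : G.IsAdinkra) (c d : Fin N → ZMod 2) (v : V) :
    G.move c (G.move d v) = G.move (c + d) v :=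
  (hG.move_move_and_moveParity c d v).1

/-- The parity of walks is a cochain with coboundary the Clifford sign. -/
theorem moveParity_move (hG : G.IsAdinkra) (c d : Fin N → ZMod 2) (v : V) :
    G.moveParity c (G.move d v) =
      cliffordSign c d + G.moveParity (c + d) v + G.moveParity d v := by
  rw [← (hG.move_move_and_moveParity c d v).2, add_right_comm, CharTwo.add_self_eq_zero, zero_add]

end IsAdinkra

theorem walk_zero (G : AdinkraData N V) (l : List (Fin N)) (v : V) :
    G.walkEnd 0 l v = v ∧ G.walkParity 0 l v = 0 := by
  induction l with
  | nil => exact ⟨rfl, rfl⟩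
  | cons i l ih => simp [walkEnd_cons, walkParity, ih]

@[simp]
theorem move_zero (G : AdinkraData N V) (v : V) : G.move 0 v = v := (G.walk_zero _ v).1

@[simp]
theorem moveParity_zero (G : AdinkraData N V) (v : V) : G.moveParity 0 v = 0 := (G.walk_zero _ v).2

theorem walk_single (G : AdinkraData N V) (i : Fin N) (l : List (Fin N)) (hl : l.Nodup) (v : V) :
    G.walkEnd (Pi.single i 1) l v = (if i ∈ l then G.nbr i v else v) ∧
      G.walkParity (Pi.single i 1) l v = if i ∈ l then G.parity i v else 0 := by
  induction l with
  | nil => simp [walkEnd, walkParity]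
  | cons j l ih =>
    obtain ⟨hj, hl⟩ := List.nodup_cons.1 hl
    obtain ⟨h1, h2⟩ := ih hl
    by_cases h : i = j
    · subst h
      simp [walkEnd_cons, walkParity, h1, h2, hj]
    · simp [walkEnd_cons, walkParity, h1, h2, h, Ne.symm h]

theorem move_single (G : AdinkraData N V) (i : Fin N) (v : V) :
    G.move (Pi.single i 1) v = G.nbr i v := by
  rw [move_eq_walkEnd, (G.walk_single i _ (List.nodup_finRange N) v).1,
    if_pos (List.mem_finRange i)]

theorem moveParity_single (G : AdinkraData N V) (i : Fin N) (v : V) :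
    G.moveParity (Pi.single i 1) v = G.parity i v := by
  rw [moveParity, (G.walk_single i _ (List.nodup_finRange N) v).2,
    if_pos (List.mem_finRange i)]

/-- A function on the vertices that changes by a constant along the edges of each colour
changes along walks accordingly. -/
theorem apply_move_of_forall_nbr {M : Type*} [AddCommGroup M] [Module (ZMod 2) M]
    (G : AdinkraData N V) (f : V → M) (t : Fin N → M)
    (h : ∀ i v, f (G.nbr i v) = f v + t i) (c : Fin N → ZMod 2) (v : V) :
    f (G.move c v) = f v + ∑ i, c i • t i := by
  have key : ∀ l : List (Fin N), f (G.walkEnd c l v) = f v + (l.map fun i => c i • t i).sum := by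
    intro l
    induction l with
    | nil => simp [walkEnd]
    | cons i l ih =>
      rw [walkEnd_cons, List.map_cons, List.sum_cons]
      obtain hc | hc := bit_eq_zero_or_one (c i)
      · simp [hc, ih]
      · simp only [hc, if_true, h, ih, one_smul]
        abel
  rw [move_eq_walkEnd, key, Fin.sum_univ_def]

theorem moveParity_eq_add_sum (G H : AdinkraData N V) (t : Fin N → ZMod 2)
    (hn : G.nbr = H.nbr) (h : ∀ i v, H.parity i v = G.parity i v + t i)
    (c : Fin N → ZMod 2) (v : V) : H.moveParity c v = G.moveParity c v + ∑ i, t i * c i := by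
  have key : ∀ l : List (Fin N),
      H.walkParity c l v = G.walkParity c l v + (l.map fun i => t i * c i).sum := by
    intro l
    induction l with
    | nil => simp [walkParity]
    | cons i l ih =>
      have he : H.walkEnd c l v = G.walkEnd c l v := by rw [walkEnd, walkEnd, hn]
      rw [walkParity, walkParity, List.map_cons, List.sum_cons, ih, h, he]
      ring
  rw [moveParity, key, moveParity, Fin.sum_univ_def]

theorem reachable_move (G : AdinkraData N V) (c : Fin N → ZMod 2) (v : V) :
    G.graph.Reachable v (G.move c v) := by
  have key : ∀ l : List (Fin N), G.graph.Reachable v (G.walkEnd c l v) := by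
    intro l
    induction l with
    | nil => exact SimpleGraph.Reachable.refl _
    | cons i l ih =>
      rw [walkEnd_cons]
      split_ifs
      · refine ih.trans ?_
        by_cases he : G.walkEnd c l v = G.nbr i (G.walkEnd c l v)
        · rw [← he]
        · exact SimpleGraph.Adj.reachable
            ((SimpleGraph.fromRel_adj _ _ _).2 ⟨he, Or.inl ⟨i, rfl⟩⟩)
      · exact ih
  exact key _

namespace IsAdinkra

variable {G : AdinkraData N V} {H : AdinkraData N W}

theorem move_self (hG : G.IsAdinkra) (c : Fin N → ZMod 2) (v : V) :
    G.move c (G.move c v) = v := by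
  rw [hG.move_move, bits_add_self, move_zero]

theorem exists_move_eq (hG : G.IsAdinkra) (v w : V) : ∃ c, G.move c v = w := by
  obtain ⟨p⟩ := hG.connected.preconnected v w
  induction p with
  | nil => exact ⟨0, G.move_zero _⟩
  | @cons a b w hab _ ih =>
    obtain ⟨c, rfl⟩ := ih
    obtain ⟨-, ⟨i, hi⟩ | ⟨i, hi⟩⟩ := (SimpleGraph.fromRel_adj _ _ _).1 hab
    · exact ⟨c + Pi.single i 1, by rw [← hG.move_move, move_single, hi]⟩
    · refine ⟨c + Pi.single i 1, ?_⟩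
      rw [← hG.move_move, move_single, ← hi, hG.nbr_nbr]

theorem fermion_move (hG : G.IsAdinkra) (c : Fin N → ZMod 2) (v : V) :
    G.fermion (G.move c v) = G.fermion v + ∑ i, c i := by
  simpa using G.apply_move_of_forall_nbr G.fermion (fun _ => 1) hG.bipartite c v

end IsAdinkra

end AdinkraData

/-! ### Characters of a code -/

theorem exists_forall_eq_sum_mul {N : ℕ} {C : Submodule (ZMod 2) (Fin N → ZMod 2)}
    (f : C →ₗ[ZMod 2] ZMod 2) :
    ∃ x : Fin N → ZMod 2, ∀ c : C, f c = ∑ i, (c : Fin N → ZMod 2) i * x i := by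
  obtain ⟨g, rfl⟩ := f.exists_extend
  refine ⟨fun i => g (Pi.single i 1), fun c => ?_⟩
  rw [LinearMap.comp_apply, Submodule.subtype_apply,
    g.pi_apply_eq_sum_univ (c : Fin N → ZMod 2)]
  simp only [smul_eq_mul]
  refine Finset.sum_congr rfl fun i _ => ?_
  congr 2
  ext j
  simp [Pi.single_apply, eq_comm]

/-- A word outside a code is detected by a parity check of the code. -/
theorem exists_sum_mul_eq_one {N : ℕ} {C : Submodule (ZMod 2) (Fin N → ZMod 2)}
    {w : Fin N → ZMod 2} (hw : w ∉ C) :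
    ∃ y : Fin N → ZMod 2, (∀ c ∈ C, ∑ i, c i * y i = 0) ∧ ∑ i, w i * y i = 1 := by
  obtain ⟨g, hg, hC⟩ := Submodule.exists_le_ker_of_notMem hw
  obtain ⟨y, hy⟩ := exists_forall_eq_sum_mul (g.comp (⊤ : Submodule (ZMod 2) _).subtype)
  refine ⟨y, fun c hc => ?_, ?_⟩
  · rw [← hy ⟨c, trivial⟩]
    exact hC hc
  · rw [← hy ⟨w, trivial⟩]
    exact (bit_eq_zero_or_one _).resolve_left hg

/-! ### The code of an Adinkra -/

namespace AdinkraData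

universe u v

variable {N : ℕ} {V : Type u} {W : Type v}

namespace IsAdinkra

variable {G : AdinkraData N V} {H : AdinkraData N W}

/-- By connectedness, a word that closes up at one vertex closes up everywhere. -/
theorem move_eq_self_of_move_eq_self (hG : G.IsAdinkra) {c : Fin N → ZMod 2} {v : V}
    (h : G.move c v = v) (w : V) : G.move c w = w := by
  obtain ⟨d, rfl⟩ := hG.exists_move_eq v w
  rw [hG.move_move, add_comm, ← hG.move_move, h]

/-- The code of an Adinkra as a linear code. -/
def code (hG : G.IsAdinkra) : Submodule (ZMod 2) (Fin N → ZMod 2) where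
  carrier := {c | ∀ v, G.move c v = v}
  zero_mem' := G.move_zero
  add_mem' := by
    intro c d hc hd v
    rw [← hG.move_move, hd, hc]
  smul_mem' := by
    intro a c hc v
    obtain rfl | rfl := bit_eq_zero_or_one a
    · simp
    · rw [one_smul, hc]

theorem hasCode_code (hG : G.IsAdinkra) : G.HasCode hG.code := fun _ => Iff.rfl

variable {C : Submodule (ZMod 2) (Fin N → ZMod 2)}

theorem move_eq_self_iff (hG : G.IsAdinkra) (hC : G.HasCode C) (c : Fin N → ZMod 2) (v : V) :
    G.move c v = v ↔ c ∈ C :=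
  ⟨fun h => (hC c).2 (hG.move_eq_self_of_move_eq_self h), fun h => (hC c).1 h v⟩

theorem move_eq_move_iff (hG : G.IsAdinkra) (hC : G.HasCode C) (c d : Fin N → ZMod 2) (v : V) :
    G.move c v = G.move d v ↔ c + d ∈ C := by
  rw [← hG.move_eq_self_iff hC (c + d) v, add_comm, ← hG.move_move]
  constructor
  · intro h
    rw [h, hG.move_self]
  · intro h
    rw [← hG.move_self d (G.move c v), h]

theorem sum_eq_zero_of_mem (hG : G.IsAdinkra) (hC : G.HasCode C) {c : Fin N → ZMod 2}
    (hc : c ∈ C) : ∑ i, c i = 0 := by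
  obtain ⟨v⟩ := hG.connected.nonempty
  simpa [(hC c).1 hc v] using hG.fermion_move c v

/-- Words of the code have even weight as closed walks alternate between bosons and fermions,
and their Clifford monomials square to `1` as they act by a sign on each vertex. -/
theorem doublyEven (hG : G.IsAdinkra) (hC : G.HasCode C) : DoublyEven C := by
  intro c hc
  refine four_dvd_hammingNorm_of (hG.sum_eq_zero_of_mem hC hc) ?_
  obtain ⟨v⟩ := hG.connected.nonempty
  have h := hG.moveParity_move c c v
  rw [(hC c).1 hc v, bits_add_self, moveParity_zero, add_zero] at h
  simpa using h

/-- The vertices are a torsor under the bit-strings modulo the code. -/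
theorem natCard_eq (hG : G.IsAdinkra) (hC : G.HasCode C) :
    Nat.card V = 2 ^ (N - Module.finrank (ZMod 2) C) := by
  obtain ⟨v⟩ := hG.connected.nonempty
  have hsub : ∀ c d : Fin N → ZMod 2, c - d = c + d := fun c d =>
    funext fun i => CharTwo.sub_eq_add (c i) (d i)
  let f : ((Fin N → ZMod 2) ⧸ C) → V := Quotient.lift (fun c => G.move c v) (by
    intro c d h
    rw [hG.move_eq_move_iff hC, ← hsub]
    exact (Submodule.quotientRel_def C).1 h)
  have hf : Function.Bijective f := by
    constructor
    · rintro ⟨c⟩ ⟨d⟩ h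
      refine (Submodule.Quotient.eq C).2 ?_
      rw [hsub]
      exact (hG.move_eq_move_iff hC c d v).1 h
    · intro w
      obtain ⟨c, rfl⟩ := hG.exists_move_eq v w
      exact ⟨Submodule.Quotient.mk c, rfl⟩
  rw [← Nat.card_congr (Equiv.ofBijective f hf), Module.natCard_eq_pow_finrank (K := ZMod 2),
    Submodule.finrank_quotient, Module.finrank_fin_fun, Nat.card_zmod]

/-! ### Adinkras with the same code -/

/-- An Adinkra is determined up to equivalence by its code, the parities of the closed walks at
one vertex, and whether that vertex is a boson. -/
theorem equivalent_of_moveParity_eq (hG : G.IsAdinkra) (hH : H.IsAdinkra) (hGC : G.HasCode C)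
    (hHC : H.HasCode C) (v₀ : V) (w₀ : W) (hf : G.fermion v₀ = H.fermion w₀)
    (hP : ∀ c ∈ C, G.moveParity c v₀ = H.moveParity c w₀) : G.Equivalent H := by
  choose r hr using hG.exists_move_eq v₀
  have he : ∀ c, H.move (r (G.move c v₀)) w₀ = H.move c w₀ := by
    intro c
    rw [hH.move_eq_move_iff hHC, ← hG.move_eq_move_iff hGC _ _ v₀, hr]
  -- The switching function does not depend on the walk chosen to reach a vertex.
  have hs : ∀ c, G.moveParity (r (G.move c v₀)) v₀ + H.moveParity (r (G.move c v₀)) w₀ =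
      G.moveParity c v₀ + H.moveParity c w₀ := by
    intro c
    set c' := r (G.move c v₀)
    have hd : c + c' ∈ C := by rw [← hG.move_eq_move_iff hGC _ _ v₀, hr]
    have hc : c + (c + c') = c' := by rw [← add_assoc, bits_add_self, zero_add]
    have h1 := hG.moveParity_move c (c + c') v₀
    have h2 := hH.moveParity_move c (c + c') w₀
    rw [(hGC _).1 hd, hc] at h1
    rw [(hHC _).1 hd, hc, ← hP _ hd] at h2
    have h3 : (2 : ZMod 2) = 0 := rfl
    linear_combination -h1 - h2 - (cliffordSign c (c + c') + G.moveParity (c + c') v₀) * h3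
  have hbij : Function.Bijective fun v => H.move (r v) w₀ := by
    constructor
    · intro v v' h
      obtain ⟨c, rfl⟩ := hG.exists_move_eq v₀ v
      obtain ⟨d, rfl⟩ := hG.exists_move_eq v₀ v'
      simp only [he] at h
      rwa [hG.move_eq_move_iff hGC, ← hH.move_eq_move_iff hHC _ _ w₀]
    · intro w
      obtain ⟨c, rfl⟩ := hH.exists_move_eq w₀ w
      exact ⟨G.move c v₀, he c⟩
  refine ⟨Equiv.ofBijective _ hbij, fun v => G.moveParity (r v) v₀ + H.moveParity (r v) w₀,
    ?_, ?_, ?_⟩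
  · intro i v
    obtain ⟨c, rfl⟩ := hG.exists_move_eq v₀ v
    simp only [Equiv.ofBijective_apply]
    rw [← move_single, hG.move_move, he, he, ← move_single, hH.move_move]
  · intro v
    obtain ⟨c, rfl⟩ := hG.exists_move_eq v₀ v
    simp only [Equiv.ofBijective_apply]
    rw [he, hH.fermion_move, hG.fermion_move, hf]
  · intro i v
    obtain ⟨c, rfl⟩ := hG.exists_move_eq v₀ v
    simp only [Equiv.ofBijective_apply]
    rw [← move_single, hG.move_move, he, hs, hs, ← moveParity_single, ← moveParity_single,
      hG.moveParity_move, hH.moveParity_move]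
    have h3 : (2 : ZMod 2) = 0 := rfl
    linear_combination - (G.moveParity c v₀ + G.moveParity (Pi.single i 1 + c) v₀) * h3

/-- Moving the base vertex by `x` changes the parities of closed walks by the character
`c ↦ (-1) ^ (x ⬝ c)` of the code. -/
theorem moveParity_move_of_mem (hG : G.IsAdinkra) (hC : G.HasCode C) {c : Fin N → ZMod 2}
    (hc : c ∈ C) (x : Fin N → ZMod 2) (v : V) :
    G.moveParity c (G.move x v) = G.moveParity c v + ∑ i, c i * x i := by
  have h1 := hG.moveParity_move c x v
  have h2 := hG.moveParity_move x c v
  have h3 := cliffordSign_add_swap c x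
  rw [(hC c).1 hc v, add_comm x] at h2
  rw [hG.sum_eq_zero_of_mem hC hc, zero_mul, zero_add] at h3
  have h4 : (2 : ZMod 2) = 0 := rfl
  linear_combination h1 + h2 + h3 + G.moveParity (c + x) v * h4

theorem moveParity_add (hG : G.IsAdinkra) (hC : G.HasCode C) (c : Fin N → ZMod 2)
    {d : Fin N → ZMod 2} (hd : d ∈ C) (v : V) :
    G.moveParity (c + d) v = cliffordSign c d + G.moveParity c v + G.moveParity d v := by
  have h := hG.moveParity_move c d v
  rw [(hC d).1 hd] at h
  have h2 : (2 : ZMod 2) = 0 := rfl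
  linear_combination -h - (cliffordSign c d + G.moveParity d v) * h2

/-- The parities of closed walks in two Adinkras with the same code differ by a character of the
code, which is absorbed by moving the base vertex. -/
theorem exists_moveParity_move_eq (hG : G.IsAdinkra) (hH : H.IsAdinkra) (hGC : G.HasCode C)
    (hHC : H.HasCode C) (v₀ : V) (w₀ : W) :
    ∃ x, ∀ c ∈ C, G.moveParity c (G.move x v₀) = H.moveParity c w₀ := by
  let f : C →ₗ[ZMod 2] ZMod 2 := AddMonoidHom.toZModLinearMap 2
    { toFun := fun c => G.moveParity c v₀ + H.moveParity c w₀
      map_zero' := by simp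
      map_add' := by
        intro c d
        have h2 : (2 : ZMod 2) = 0 := rfl
        rw [Submodule.coe_add, hG.moveParity_add hGC _ d.2, hH.moveParity_add hHC _ d.2]
        linear_combination (cliffordSign c.1 d.1) * h2 }
  obtain ⟨x, hx⟩ := exists_forall_eq_sum_mul f
  refine ⟨x, fun c hc => ?_⟩
  have h : G.moveParity c v₀ + H.moveParity c w₀ = ∑ i, c i * x i := hx ⟨c, hc⟩
  rw [hG.moveParity_move_of_mem hGC hc, ← h, ← add_assoc, CharTwo.add_self_eq_zero, zero_add]

end IsAdinkra

/-- Two Adinkras equivalent to the same one are equivalent. -/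
theorem Equivalent.trans_symm {X : Type*} {G : AdinkraData N V} {H : AdinkraData N W}
    {K : AdinkraData N X} (hG : G.Equivalent K) (hH : H.Equivalent K) : G.Equivalent H := by
  obtain ⟨e, s, he, hf, hp⟩ := hG
  obtain ⟨e', s', he', hf', hp'⟩ := hH
  have hn : ∀ i v, e'.symm (e (G.nbr i v)) = H.nbr i (e'.symm (e v)) := by
    intro i v
    rw [Equiv.symm_apply_eq, he', Equiv.apply_symm_apply, he]
  refine ⟨e.trans e'.symm, fun v => s v + s' (e'.symm (e v)), hn, ?_, ?_⟩
  · intro v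
    rw [Equiv.trans_apply, ← hf', Equiv.apply_symm_apply, hf]
  · intro i v
    have h1 := hp i v
    have h2 := hp' i (e'.symm (e v))
    rw [Equiv.apply_symm_apply, ← hn] at h2
    have h4 : (2 : ZMod 2) = 0 := rfl
    rw [Equiv.trans_apply]
    linear_combination h1 - h2 - (s' (e'.symm (e v)) + s' (e'.symm (e (G.nbr i v)))) * h4

end AdinkraData

/-! ### Standard forms -/

theorem hammingNorm_comp_equiv {ι κ : Type*} [Fintype ι] [Fintype κ] (σ : κ ≃ ι)
    (f : ι → ZMod 2) : hammingNorm (fun i => f (σ i)) = hammingNorm f := by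
  rw [hammingNorm_eq_sum, hammingNorm_eq_sum, Equiv.sum_comp σ fun i => (f i).val]

theorem hammingNorm_sumElim {ι κ : Type*} [Fintype ι] [Fintype κ] (f : ι → ZMod 2)
    (g : κ → ZMod 2) : hammingNorm (Sum.elim f g) = hammingNorm f + hammingNorm g := by
  simp [hammingNorm_eq_sum]

/-- A word spanned by the rows `(I | A)` is determined by its extra coordinates. -/
theorem mem_span_range_standardRow_iff {N n k : ℕ} (σ : Fin n ⊕ Fin k ≃ Fin N)
    (A : Matrix (Fin k) (Fin n) (ZMod 2)) (c : Fin N → ZMod 2) :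
    c ∈ Submodule.span (ZMod 2) (Set.range (standardRow σ A)) ↔
      ∀ j, c (σ (Sum.inl j)) = ∑ i, c (σ (Sum.inr i)) * A i j := by
  have hl : ∀ (a : Fin k → ZMod 2) j,
      (∑ i, a i • standardRow σ A i) (σ (Sum.inl j)) = ∑ i, a i * A i j := by
    intro a j
    simp [standardRow]
  have hr : ∀ (a : Fin k → ZMod 2) i,
      (∑ i, a i • standardRow σ A i) (σ (Sum.inr i)) = a i := by
    intro a i
    simp [standardRow, Matrix.one_apply]
  rw [Submodule.mem_span_range_iff_exists_fun]
  constructor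
  · rintro ⟨a, rfl⟩ j
    simp only [hl, hr]
  · intro h
    refine ⟨fun i => c (σ (Sum.inr i)), ?_⟩
    ext m
    obtain ⟨m | m, rfl⟩ := σ.surjective m
    · rw [hl, h]
    · rw [hr]

/-- Coordinates restrict to a spanning set of the dual of a code, so that some of them form a
basis of it. These are the extra coordinates, and the dual basis gives the rows. -/
theorem exists_isStandardForm {N k : ℕ} (C : Submodule (ZMod 2) (Fin N → ZMod 2))
    (hk : Module.finrank (ZMod 2) C = k) :
    ∃ (σ : Fin (N - k) ⊕ Fin k ≃ Fin N) (A : Matrix (Fin k) (Fin (N - k)) (ZMod 2)),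
      IsStandardForm C σ A := by
  classical
  let φ : Fin N → Module.Dual (ZMod 2) C := fun i => (LinearMap.proj i).comp C.subtype
  have hφ : Submodule.span (ZMod 2) (Set.range φ) = ⊤ := by
    rw [eq_top_iff]
    intro f _
    obtain ⟨x, hx⟩ := exists_forall_eq_sum_mul f
    rw [Submodule.mem_span_range_iff_exists_fun]
    refine ⟨x, LinearMap.ext fun c => ?_⟩
    rw [hx]
    simp [φ, mul_comm]
  obtain ⟨κ, a, ha, hspan, hli⟩ := exists_linearIndependent' (ZMod 2) φ
  have : Finite κ := Finite.of_injective a ha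
  have : Fintype κ := Fintype.ofFinite κ
  let B : Module.Basis κ (ZMod 2) (Module.Dual (ZMod 2) C) :=
    Module.Basis.mk hli (by rw [hspan, hφ])
  have hcard : Fintype.card κ = k := by
    rw [← hk, ← Subspace.dual_finrank_eq, Module.finrank_eq_card_basis B]
  let τ : Fin k ≃ κ := (Fintype.equivFinOfCardEq hcard).symm
  have hrange : Fintype.card (Set.range (a ∘ τ) : Set (Fin N)) = k := by
    rw [Set.card_range_of_injective (ha.comp τ.injective), Fintype.card_fin]
  have hcompl : Fintype.card ((Set.range (a ∘ τ))ᶜ : Set (Fin N)) = N - k := by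
    rw [Fintype.card_compl_set, hrange, Fintype.card_fin]
  let σ : Fin (N - k) ⊕ Fin k ≃ Fin N :=
    (Equiv.sumComm _ _).trans <| (Equiv.sumCongr (Equiv.ofInjective _ (ha.comp τ.injective))
      (Fintype.equivFinOfCardEq hcompl).symm).trans (Equiv.Set.sumCompl _)
  have hσ : ∀ i, σ (Sum.inr i) = a (τ i) := fun i => by simp [σ]
  -- The extra coordinates form a basis of the dual, so they separate words.
  have hinj : ∀ c : C, (∀ i, (c : Fin N → ZMod 2) (σ (Sum.inr i)) = 0) → c = 0 := by
    intro c hc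
    refine (Module.forall_dual_apply_eq_zero_iff (ZMod 2) c).1 fun f => ?_
    have h0 : B.constr (ZMod 2) (fun _ => (0 : ZMod 2)) = Module.Dual.eval (ZMod 2) C c := by
      refine B.ext fun i => ?_
      have h := hc (τ.symm i)
      rw [hσ, Equiv.apply_symm_apply] at h
      rw [Module.Basis.constr_basis]
      simp [B, φ, h]
    rw [← Module.Dual.eval_apply, ← h0]
    simp
  let E : C →ₗ[ZMod 2] (Fin k → ZMod 2) :=
    LinearMap.pi fun i => (LinearMap.proj (σ (Sum.inr i))).comp C.subtype
  have hE : Function.Injective E :=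
    (injective_iff_map_eq_zero E).2 fun c hc => hinj c fun i => congrFun hc i
  have hEs : Function.Surjective E :=
    (LinearMap.injective_iff_surjective_of_finrank_eq_finrank (by simp [hk])).1 hE
  choose row hrow using fun i : Fin k => hEs (Pi.single i 1)
  have hrow' : ∀ i i', (row i : Fin N → ZMod 2) (σ (Sum.inr i')) =
      (Pi.single i 1 : Fin k → ZMod 2) i' := fun i i' => congrFun (hrow i) i'
  refine ⟨σ, fun i j => (row i : Fin N → ZMod 2) (σ (Sum.inl j)), ?_⟩
  have hstd : ∀ i, standardRow σ (fun i j => (row i : Fin N → ZMod 2) (σ (Sum.inl j))) i =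
      row i := by
    intro i
    ext m
    obtain ⟨m | m, rfl⟩ := σ.surjective m
    · simp [standardRow]
    · simp [standardRow, Matrix.one_eq_pi_single, hrow']
  refine le_antisymm (fun c hc => ?_) (Submodule.span_le.2 ?_)
  · have hsum : (⟨c, hc⟩ : C) = ∑ i, c (σ (Sum.inr i)) • row i := by
      refine hE ?_
      simp only [map_sum, map_smul, hrow]
      ext i
      simp [E, Pi.single_apply]
    have hsum' : c = ∑ i, c (σ (Sum.inr i)) • (row i : Fin N → ZMod 2) := by
      simpa using congrArg Subtype.val hsum
    rw [Submodule.mem_span_range_iff_exists_fun]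
    exact ⟨_, by simp only [hstd]; exact hsum'.symm⟩
  · rintro _ ⟨i, rfl⟩
    rw [hstd]
    exact (row i).2

/-! ### Landweber's construction -/

section Landweber

variable {N n k : ℕ} {C : Submodule (ZMod 2) (Fin N → ZMod 2)} {σ : Fin n ⊕ Fin k ≃ Fin N}
  {A : Matrix (Fin k) (Fin n) (ZMod 2)}

theorem standardRow_mem (hA : IsStandardForm C σ A) (i : Fin k) : standardRow σ A i ∈ C := by
  rw [hA]
  exact Submodule.subset_span ⟨i, rfl⟩

theorem hammingNorm_row_mod_four (hC : DoublyEven C) (hA : IsStandardForm C σ A) (i : Fin k) :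
    hammingNorm (A i) % 4 = 3 := by
  have h := hC _ (standardRow_mem hA i)
  have h1 : hammingNorm (standardRow σ A i) = hammingNorm (A i) + 1 := by
    have h2 : standardRow σ A i = fun c => Sum.elim (A i) (Pi.single i 1) (σ.symm c) := by
      ext c
      obtain ⟨m | m, rfl⟩ := σ.surjective c <;> simp [standardRow, Matrix.one_eq_pi_single]
    rw [h2, hammingNorm_comp_equiv, hammingNorm_sumElim, hammingNorm_single]
  omega

theorem hammingNorm_row_add_row_mod_four (hC : DoublyEven C) (hA : IsStandardForm C σ A)
    {i j : Fin k} (hij : i ≠ j) : hammingNorm (A i + A j) % 4 = 2 := by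
  have h := hC _ (add_mem (standardRow_mem hA i) (standardRow_mem hA j))
  have h1 : hammingNorm (standardRow σ A i + standardRow σ A j) = hammingNorm (A i + A j) + 2 := by
    have h2 : hammingNorm (Pi.single i 1 + Pi.single j 1 : Fin k → ZMod 2) = 2 := by
      have h3 : ∀ m, ((Pi.single i 1 : Fin k → ZMod 2) m + (Pi.single j 1 : Fin k → ZMod 2) m).val =
          (if m = i then 1 else 0) + if m = j then 1 else 0 := by
        intro m
        by_cases hi : m = i
        · subst hi
          simp [hij, ZMod.val_one]
        · by_cases hj : m = j
          · subst hj
            simp [hi, ZMod.val_one]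
          · simp [hi, hj]
      simp only [hammingNorm_eq_sum, Pi.add_apply, h3, Finset.sum_add_distrib]
      simp
    have h4 : standardRow σ A i + standardRow σ A j =
        fun c => Sum.elim (A i + A j) (Pi.single i 1 + Pi.single j 1) (σ.symm c) := by
      ext c
      obtain ⟨m | m, rfl⟩ := σ.surjective c <;>
        simp [standardRow, Matrix.one_eq_pi_single]
    rw [h4, hammingNorm_comp_equiv, hammingNorm_sumElim, h2]
  omega

theorem sum_row (hC : DoublyEven C) (hA : IsStandardForm C σ A) (i : Fin k) :
    ∑ j, A i j = 1 := by
  rw [← natCast_hammingNorm, ← ZMod.natCast_mod]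
  have h := hammingNorm_row_mod_four hC hA i
  rw [show hammingNorm (A i) % 2 = 1 by omega, Nat.cast_one]

theorem cliffordSign_row_self (hC : DoublyEven C) (hA : IsStandardForm C σ A) (i : Fin k) :
    cliffordSign (A i) (A i) = 1 := by
  rw [cliffordSign_self, natCast_choose_two_mod_four, hammingNorm_row_mod_four hC hA]
  rfl

theorem cliffordSign_row_add_swap (hC : DoublyEven C) (hA : IsStandardForm C σ A) {i j : Fin k}
    (hij : i ≠ j) : cliffordSign (A i) (A j) + cliffordSign (A j) (A i) = 1 := by
  have h : cliffordSign (A i + A j) (A i + A j) = 1 := by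
    rw [cliffordSign_self, natCast_choose_two_mod_four, hammingNorm_row_add_row_mod_four hC hA hij]
    rfl
  rw [cliffordSign_add_left, cliffordSign_add_right, cliffordSign_add_right,
    cliffordSign_row_self hC hA, cliffordSign_row_self hC hA] at h
  have h2 : (2 : ZMod 2) = 0 := rfl
  linear_combination h - h2

/-- The step along the edges of the colour `c` in Landweber's construction. -/
def landweberStep (σ : Fin n ⊕ Fin k ≃ Fin N) (A : Matrix (Fin k) (Fin n) (ZMod 2)) (c : Fin N) :
    Fin n → ZMod 2 :=
  Sum.elim (fun j => Pi.single j 1) A (σ.symm c)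

theorem landweberStep_inl (j : Fin n) :
    landweberStep σ A (σ (Sum.inl j)) = Pi.single j 1 := by
  rw [landweberStep, Equiv.symm_apply_apply]
  rfl

theorem landweberStep_inr (i : Fin k) : landweberStep σ A (σ (Sum.inr i)) = A i := by
  rw [landweberStep, Equiv.symm_apply_apply]
  rfl

theorem landweber_nbr (ε b : ZMod 2) (c : Fin N) (v : Fin n → ZMod 2) :
    (landweber σ A ε b).nbr c v = v + landweberStep σ A c := rfl

theorem landweber_parity_inl (ε b : ZMod 2) (j : Fin n) (v : Fin n → ZMod 2) :
    (landweber σ A ε b).parity (σ (Sum.inl j)) v = cliffordSign (Pi.single j 1) v := by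
  simp [landweber]

theorem landweber_parity_inr (ε b : ZMod 2) (i : Fin k) (v : Fin n → ZMod 2) :
    (landweber σ A ε b).parity (σ (Sum.inr i)) v = cliffordSign v (A i) + ∑ j, v j + ε := by
  simp [landweber]

theorem landweber_move (ε b : ZMod 2) (c : Fin N → ZMod 2) (v : Fin n → ZMod 2) :
    (landweber σ A ε b).move c v = v + ∑ i, c i • landweberStep σ A i :=
  AdinkraData.apply_move_of_forall_nbr _ id (landweberStep σ A) (fun _ _ => rfl) c v

/-- The end of a walk in coordinates; it is its start exactly if the word is the combination of
the rows `(I | A)` given by its extra coordinates. -/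
theorem sum_smul_landweberStep (c : Fin N → ZMod 2) (j : Fin n) :
    (∑ i, c i • landweberStep σ A i) j =
      c (σ (Sum.inl j)) + ∑ i, c (σ (Sum.inr i)) * A i j := by
  rw [← Equiv.sum_comp σ, Fintype.sum_sum_type]
  simp [landweberStep_inl, landweberStep_inr, Pi.single_apply]

theorem landweber_hasCode (hA : IsStandardForm C σ A) (ε b : ZMod 2) :
    (landweber σ A ε b).HasCode C := by
  intro c
  rw [hA, mem_span_range_standardRow_iff]
  have h : ∀ x y : ZMod 2, x = y ↔ x + y = 0 := by decide
  simp only [landweber_move, add_eq_left, forall_const]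
  rw [funext_iff]
  simp only [sum_smul_landweberStep, Pi.zero_apply, ← h]

theorem sum_landweberStep (hC : DoublyEven C) (hA : IsStandardForm C σ A) (c : Fin N) :
    ∑ j, landweberStep σ A c j = 1 := by
  obtain ⟨j | i, rfl⟩ := σ.surjective c
  · simp [landweberStep_inl]
  · rw [landweberStep_inr, sum_row hC hA]

/-- Two generators anticommute, and left and right multiplications commute, so that the factor
`(-1) ^ F` makes them anticommute; two extra colours anticommute because the rows of `A` do, all
of them being of odd weight. -/
theorem landweber_odd_dashing (hC : DoublyEven C) (hA : IsStandardForm C σ A) (ε b : ZMod 2)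
    {i j : Fin N} (hij : i ≠ j) (v : Fin n → ZMod 2) :
    (landweber σ A ε b).parity i v +
      (landweber σ A ε b).parity j ((landweber σ A ε b).nbr i v) +
      (landweber σ A ε b).parity i
        ((landweber σ A ε b).nbr j ((landweber σ A ε b).nbr i v)) +
      (landweber σ A ε b).parity j ((landweber σ A ε b).nbr i
        ((landweber σ A ε b).nbr j ((landweber σ A ε b).nbr i v))) = 1 := by
  have hs := fun i => sum_row hC hA i
  have hsingle : ∀ j : Fin n, ∑ m, (Pi.single j 1 : Fin n → ZMod 2) m = 1 := fun j => by simp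
  have hr := fun i => cliffordSign_row_self hC hA i
  obtain ⟨i | i, rfl⟩ := σ.surjective i <;> obtain ⟨j | j, rfl⟩ := σ.surjective j <;>
    simp only [landweber_nbr, landweber_parity_inl, landweber_parity_inr, landweberStep_inl,
      landweberStep_inr, cliffordSign_add_left, cliffordSign_add_right, cliffordSign_single_self,
      Pi.add_apply, Finset.sum_add_distrib, hs, hr, hsingle]
  · have h := cliffordSign_single_add_swap (n := n) (i := i) (j := j) (by rintro rfl; exact hij rfl)
    grind
  · grind
  · grind
  · have h := cliffordSign_row_add_swap hC hA (i := i) (j := j) (by rintro rfl; exact hij rfl)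
    grind

theorem landweber_isAdinkra (hC : DoublyEven C) (hA : IsStandardForm C σ A) (ε b : ZMod 2) :
    (landweber σ A ε b).IsAdinkra := by
  have hnn : ∀ (i : Fin N) (v : Fin n → ZMod 2),
      (landweber σ A ε b).nbr i ((landweber σ A ε b).nbr i v) = v := by
    intro i v
    rw [landweber_nbr, landweber_nbr, add_assoc, bits_add_self, add_zero]
  have hbip : ∀ (i : Fin N) (v : Fin n → ZMod 2), (landweber σ A ε b).fermion
      ((landweber σ A ε b).nbr i v) = (landweber σ A ε b).fermion v + 1 := by
    intro i v
    rw [← sum_landweberStep hC hA i]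
    simp only [landweber, landweberStep, Pi.add_apply, Finset.sum_add_distrib, add_assoc]
  have hodd := fun (i j : Fin N) v (hij : i ≠ j) => landweber_odd_dashing hC hA ε b hij v
  refine ⟨?_, hnn, ?_, ?_, hbip, ?_, ?_, ?_, fun i j v hij => hodd i j v hij⟩
  · have : Nonempty (Fin n → ZMod 2) := ⟨0⟩
    refine SimpleGraph.Connected.mk fun v w => ?_
    have h := (landweber σ A ε b).reachable_move
      (fun c => Sum.elim (v + w) (0 : Fin k → ZMod 2) (σ.symm c)) v
    convert h using 1
    rw [landweber_move]
    ext j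
    rw [Pi.add_apply, sum_smul_landweberStep]
    simp [← add_assoc, CharTwo.add_self_eq_zero]
  · intro i v h
    have h1 := hbip i v
    rw [h] at h1
    simp at h1
  · -- A double edge would bound a 4-cycle that traverses each of its two edges twice.
    intro i j v hij h
    have h1 := hodd i j v hij
    have h3 : (landweber σ A ε b).nbr j ((landweber σ A ε b).nbr j v) = v := hnn j v
    rw [← h] at h3
    rw [h3, add_assoc, CharTwo.add_self_eq_zero] at h1
    exact zero_ne_one h1
  · intro i v
    have h1 : ∀ z : ZMod 2, |((z + 1).val : ℤ) - z.val| = 1 := by decide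
    have h3 := h1 ((landweber σ A ε b).fermion v)
    rwa [← hbip i v] at h3
  · intro i v
    obtain ⟨i | i, rfl⟩ := σ.surjective i
    · rw [landweber_nbr, landweber_parity_inl, landweber_parity_inl, landweberStep_inl,
        cliffordSign_add_right, cliffordSign_single_self, add_zero]
    · simp only [landweber_nbr, landweber_parity_inr, landweberStep_inr, cliffordSign_add_left,
        cliffordSign_row_self hC hA, Pi.add_apply, Finset.sum_add_distrib, sum_row hC hA]
      have h2 : (2 : ZMod 2) = 0 := rfl
      linear_combination h2
  · intro i j v hij
    simp only [landweber_nbr]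
    rw [show v + landweberStep σ A i + landweberStep σ A j + landweberStep σ A i +
      landweberStep σ A j = v + (landweberStep σ A i + landweberStep σ A i) +
        (landweberStep σ A j + landweberStep σ A j) by abel, bits_add_self, bits_add_self,
      add_zero, add_zero]

theorem card_eq_of_equiv (σ : Fin n ⊕ Fin k ≃ Fin N) : n + k = N := by
  simpa using Fintype.card_congr σ

theorem landweber_isNK (hC : DoublyEven C) (hA : IsStandardForm C σ A) (ε b : ZMod 2) :
    (landweber σ A ε b).IsNK k := by
  have h := card_eq_of_equiv σ
  refine ⟨landweber_isAdinkra hC hA ε b, by omega, ?_⟩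
  rw [show N - k = n by omega]
  simp

/-- A nontrivial global sign changes the parity of a walk by the number of its extra colours; the
choice of the bosons does not matter. -/
theorem landweber_moveParity (ε b : ZMod 2) (c : Fin N → ZMod 2) (v : Fin n → ZMod 2) :
    (landweber σ A ε b).moveParity c v = (landweber σ A 0 0).moveParity c v +
      ε * ∑ i, c (σ (Sum.inr i)) := by
  rw [(landweber σ A 0 0).moveParity_eq_add_sum (landweber σ A ε b)
    (fun m => Sum.elim (fun _ => 0) (fun _ => ε) (σ.symm m)) rfl ?_ c v, ← Equiv.sum_comp σ,
    Fintype.sum_sum_type, Finset.mul_sum]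
  · simp
  · intro i v
    obtain ⟨i | i, rfl⟩ := σ.surjective i <;> simp [landweber]

end Landweber

/-! ### The classification -/

namespace AdinkraData.IsAdinkra

variable {N n k : ℕ} {V : Type*} {G : AdinkraData N V} {C : Submodule (ZMod 2) (Fin N → ZMod 2)}
  {σ : Fin n ⊕ Fin k ≃ Fin N} {A : Matrix (Fin k) (Fin n) (ZMod 2)}

/-- If the closed walks at `v` have the same parities as those at the vertex `0` of Landweber's
construction, then `v` can take the place of `0`, and its statistics determine the bosons. -/
theorem equivalent_landweber_of_fermion_eq (hG : G.IsAdinkra) (hC : G.HasCode C)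
    (hA : IsStandardForm C σ A) (ε : ZMod 2) (v : V)
    (h : ∀ c ∈ C, G.moveParity c v = (landweber σ A ε 0).moveParity c 0) :
    G.Equivalent (landweber σ A ε (G.fermion v)) := by
  refine hG.equivalent_of_moveParity_eq (landweber_isAdinkra (hG.doublyEven hC) hA _ _) hC
    (landweber_hasCode hA _ _) v 0 ?_ fun c hc => ?_
  · simp [landweber]
  · rw [h c hc, landweber_moveParity ε 0, landweber_moveParity ε (G.fermion v)]

/-- Some vertex of `G` has the same parities of closed walks as the vertex `0` of Landweber's
construction, for either global sign. -/
theorem exists_moveParity_eq_landweber (hG : G.IsAdinkra) (hC : G.HasCode C)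
    (hA : IsStandardForm C σ A) (ε : ZMod 2) :
    ∃ v, ∀ c ∈ C, G.moveParity c v = (landweber σ A ε 0).moveParity c 0 := by
  obtain ⟨v₀⟩ := hG.connected.nonempty
  obtain ⟨x, hx⟩ := hG.exists_moveParity_move_eq (landweber_isAdinkra (hG.doublyEven hC) hA ε 0)
    hC (landweber_hasCode hA ε 0) v₀ 0
  exact ⟨_, hx⟩

theorem exists_boson_equivalent_landweber (hG : G.IsAdinkra) (hC : G.HasCode C)
    (hA : IsStandardForm C σ A) (ε : ZMod 2) : ∃ b, G.Equivalent (landweber σ A ε b) := by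
  obtain ⟨v, hv⟩ := hG.exists_moveParity_eq_landweber hC hA ε
  exact ⟨_, hG.equivalent_landweber_of_fermion_eq hC hA ε v hv⟩

/-- If the base vertex has the wrong statistics, it is moved by a word of odd weight. When the
all-ones word is not in the code, this word can be chosen orthogonal to the code, so that no
parities change. The word of all extra colours changes the parities as the global sign does, and
has odd weight if `k` is odd. -/
theorem exists_sign_equivalent_landweber (hG : G.IsAdinkra) (hC : G.HasCode C)
    (hA : IsStandardForm C σ A) (hk : Odd k ∨ (1 : Fin N → ZMod 2) ∉ C) (b : ZMod 2) :
    ∃ ε, G.Equivalent (landweber σ A ε b) := by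
  obtain ⟨v, hv⟩ := hG.exists_moveParity_eq_landweber hC hA 0
  by_cases hb : G.fermion v = b
  · exact ⟨0, hb ▸ hG.equivalent_landweber_of_fermion_eq hC hA 0 v hv⟩
  have hb' : G.fermion v + 1 = b := by
    have h : ∀ x y : ZMod 2, x ≠ y → x + 1 = y := by decide
    exact h _ _ hb
  -- It suffices to find a word of odd weight that changes the parities as the sign `ε` does.
  have key : ∀ (ε : ZMod 2) (y : Fin N → ZMod 2), ∑ i, y i = 1 →
      (∀ c ∈ C, ∑ i, c i * y i = ε * ∑ i, c (σ (Sum.inr i))) →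
      ∃ ε, G.Equivalent (landweber σ A ε b) := by
    intro ε y hy hyC
    have h := hG.equivalent_landweber_of_fermion_eq hC hA ε (G.move y v) fun c hc => by
      rw [hG.moveParity_move_of_mem hC hc, hyC c hc, hv c hc, ← landweber_moveParity]
    rw [hG.fermion_move, hy, hb'] at h
    exact ⟨ε, h⟩
  obtain hk | h1 := hk
  · refine key 1 (fun m => Sum.elim (fun _ => 0) (fun _ => 1) (σ.symm m)) ?_ fun c _ => ?_
    · rw [← Equiv.sum_comp σ, Fintype.sum_sum_type]
      simpa using (ZMod.natCast_eq_one_iff_odd).2 hk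
    · rw [← Equiv.sum_comp σ, Fintype.sum_sum_type]
      simp
  · obtain ⟨y, hyC, hy⟩ := exists_sum_mul_eq_one h1
    exact key 0 y (by simpa using hy) fun c hc => by rw [hyC c hc, zero_mul]

theorem isNK_finrank (hG : G.IsAdinkra) (hC : G.HasCode C) :
    G.IsNK (Module.finrank (ZMod 2) C) :=
  ⟨hG, by simpa using Submodule.finrank_le C, hG.natCard_eq hC⟩

theorem exists_isStandardForm_code (hG : G.IsAdinkra) (hC : G.HasCode C) (hk : G.IsNK k) :
    Module.finrank (ZMod 2) C = k ∧
      ∃ (σ : Fin (N - k) ⊕ Fin k ≃ Fin N) (A : Matrix (Fin k) (Fin (N - k)) (ZMod 2)),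
        IsStandardForm C σ A := by
  obtain ⟨-, hle, hcard⟩ := hG.isNK_finrank hC
  have h := Nat.pow_right_injective le_rfl (hcard.symm.trans hk.2.2)
  have hk' := hk.2.1
  have hfr : Module.finrank (ZMod 2) C = k := by
    omega
  exact ⟨hfr, exists_isStandardForm C hfr⟩

end AdinkraData.IsAdinkra

theorem mainTheorem2 :
    -- the construction yields Adinkras with the prescribed code
    (∀ (N n k : ℕ) (C : Submodule (ZMod 2) (Fin N → ZMod 2))
      (σ : Fin n ⊕ Fin k ≃ Fin N) (A : Matrix (Fin k) (Fin n) (ZMod 2)),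
      DoublyEven C → IsStandardForm C σ A → ∀ ε b : ZMod 2,
        (landweber σ A ε b).IsNK k ∧ (landweber σ A ε b).HasCode C) ∧
    -- the construction yields all Adinkras up to equivalence
    (∀ (N k : ℕ) (V : Type*) (G : AdinkraData N V), G.IsNK k →
      ∃ C : Submodule (ZMod 2) (Fin N → ZMod 2),
        G.HasCode C ∧ DoublyEven C ∧ Module.finrank (ZMod 2) C = k ∧
        (∃ (σ : Fin (N - k) ⊕ Fin k ≃ Fin N) (A : Matrix (Fin k) (Fin (N - k)) (ZMod 2)),
          IsStandardForm C σ A) ∧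
        ∀ (σ : Fin (N - k) ⊕ Fin k ≃ Fin N) (A : Matrix (Fin k) (Fin (N - k)) (ZMod 2)),
          IsStandardForm C σ A →
            (∀ ε : ZMod 2, ∃ b : ZMod 2, G.Equivalent (landweber σ A ε b)) ∧
            (Odd k ∨ (1 : Fin N → ZMod 2) ∉ C →
              ∀ b : ZMod 2, ∃ ε : ZMod 2, G.Equivalent (landweber σ A ε b))) ∧
    -- there are at most two equivalence classes for each code
    (∀ (N : ℕ) (C : Submodule (ZMod 2) (Fin N → ZMod 2)) (V₁ V₂ V₃ : Type*)
      (G₁ : AdinkraData N V₁) (G₂ : AdinkraData N V₂) (G₃ : AdinkraData N V₃),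
      G₁.IsAdinkra → G₂.IsAdinkra → G₃.IsAdinkra →
      G₁.HasCode C → G₂.HasCode C → G₃.HasCode C →
      G₁.Equivalent G₂ ∨ G₁.Equivalent G₃ ∨ G₂.Equivalent G₃) := by
  refine ⟨fun N n k C σ A hC hA ε b => ⟨landweber_isNK hC hA ε b, landweber_hasCode hA ε b⟩,
    fun N k V G hG => ?_, fun N C V₁ V₂ V₃ G₁ G₂ G₃ h₁ h₂ h₃ hC₁ hC₂ hC₃ => ?_⟩
  · have hC := hG.1.hasCode_code
    obtain ⟨hk, hstd⟩ := hG.1.exists_isStandardForm_code hC hG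
    exact ⟨_, hC, hG.1.doublyEven hC, hk, hstd, fun σ A hA =>
      ⟨hG.1.exists_boson_equivalent_landweber hC hA,
        hG.1.exists_sign_equivalent_landweber hC hA⟩⟩
  · -- With the standard form and the sign fixed, only the choice of the bosons is left.
    obtain ⟨-, σ, A, hA⟩ := h₁.exists_isStandardForm_code hC₁ (h₁.isNK_finrank hC₁)
    obtain ⟨b₁, e₁⟩ := h₁.exists_boson_equivalent_landweber hC₁ hA 0
    obtain ⟨b₂, e₂⟩ := h₂.exists_boson_equivalent_landweber hC₂ hA 0
    obtain ⟨b₃, e₃⟩ := h₃.exists_boson_equivalent_landweber hC₃ hA 0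
    have h : ∀ x y z : ZMod 2, x = y ∨ x = z ∨ y = z := by decide
    obtain rfl | rfl | rfl := h b₁ b₂ b₃
    · exact Or.inl (e₁.trans_symm e₂)
    · exact Or.inr (Or.inl (e₁.trans_symm e₃))
    · exact Or.inr (Or.inr (e₂.trans_symm e₃))
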